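/- Let $d,b,m,n$ be natural numbers with $n\ge 1$, let $\psi\colon\mathbb R^d\to\mathbb R^b$ be a fixed measurable feature map, and let $a\in\mathbb R^m$ be a fixed attribute vector. For a matrix $W\in\mathbb R^{m\times b}$ the bilinear linear-in-attribute model is $g(x,a)=a^\top W\psi(x)=\tilde w^\top\tilde x$, where $\tilde w=\mathrm{vec}(W^\top)\in\mathbb R^{mb}$ and $\tilde x=\mathrm{vec}(\psi(x)a^\top)\in\mathbb R^{mb}$. For $B_w>0$ let $$\mathcal H=\{\,h\colon\mathbb R^{mb}\to\mathbb R \;:\; h(\tilde x)=\tilde w^\top\tilde x,\ \tilde w=\mathrm{vec}(W^\top),\ W\in\mathbb R^{m\times b},\ \|\tilde w\|_2\le B_w\,\}.$$ Let $x$ be a random vector in $\mathbb R^d$ with an arbitrary law, let $Q$ be the law of $\tilde x=\mathrm{vec}(\psi(x)a^\top)$, and let $\tilde x_1,\dots,\tilde x_n$ be drawn independently from $Q$. Let $f_Q\colon\mathbb R^{mb}\to\mathbb R$ be a measurable labeling function, so that the labels are $y_i=f_Q(\tilde x_i)$. Let $q\ge 1$ be real, $\ell_q(y,y')=|y-y'|^q$,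 and $$J_Q(h)=\mathbb E_{\tilde x\sim Q}\big[\ell_q(h(\tilde x),f_Q(\tilde x))\big],\qquad \widehat J_Q(h)=\frac1n\sum_{i=1}^n\ell_q(h(\tilde x_i),f_Q(\tilde x_i)).$$ Assume that $\|\psi(x)\|_2\le B_x$ almost surely, that $\|a\|_2\le B_a$, and that there is $M>0$ such that for $Q$-almost every $\tilde x$, $|h(\tilde x)-f_Q(\tilde x)|\le M$ for all $h\in\mathcal H$. Then for every $\delta>0$, with probability at least $1-\delta$ over the sample, the following holds simultaneously for all $h\in\mathcal H$: $$J_Q(h)\;\le\;\widehat J_Q(h)+\frac{2qM^{q-1}B}{\sqrt n}+M^q\sqrt{\frac{\ln(1/\delta)}{2n}},\qquad B=B_wB_xB_a.$$ (For $\delta>1$ the claim is void, since $1-\delta<0$.) -/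

import Mathlib

open MeasureTheory
open scoped Matrix RealInnerProductSpace

noncomputable section

/-- The bilinear linear-in-attribute model `g(x, a) = aᵀ W ψ(x)`. -/
def bilinearLAM {d b m : ℕ} (ψ : EuclideanSpace ℝ (Fin d) → EuclideanSpace ℝ (Fin b))
    (W : Matrix (Fin m) (Fin b) ℝ) (x : EuclideanSpace ℝ (Fin d))
    (a : EuclideanSpace ℝ (Fin m)) : ℝ :=
  a.ofLp ⬝ᵥ (W *ᵥ (ψ x).ofLp)

/-- The vectorized weight `vec(Wᵀ)`, a Euclidean vector; its `(i, j)` coordinate is `W i j`. -/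
def weightVec {b m : ℕ} (W : Matrix (Fin m) (Fin b) ℝ) :
    EuclideanSpace ℝ (Fin m × Fin b) :=
  WithLp.toLp 2 Wᵀ.vec

/-- The vectorized input `vec(ψ(x) aᵀ)`, a Euclidean vector;
its `(i, j)` coordinate is `ψ(x)ⱼ aᵢ`. -/
def liftedInput {d b m : ℕ} (ψ : EuclideanSpace ℝ (Fin d) → EuclideanSpace ℝ (Fin b))
    (a : EuclideanSpace ℝ (Fin m)) (x : EuclideanSpace ℝ (Fin d)) :
    EuclideanSpace ℝ (Fin m × Fin b) :=
  WithLp.toLp 2 (Matrix.vecMulVec (ψ x).ofLp a.ofLp).vec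

/-- The bilinear model is the linear function `w̃ᵀ x̃` of the vectorized input. -/
theorem bilinearLAM_eq_inner {d b m : ℕ}
    (ψ : EuclideanSpace ℝ (Fin d) → EuclideanSpace ℝ (Fin b))
    (W : Matrix (Fin m) (Fin b) ℝ) (x : EuclideanSpace ℝ (Fin d))
    (a : EuclideanSpace ℝ (Fin m)) :
    bilinearLAM ψ W x a = ⟪weightVec W, liftedInput ψ a x⟫ := by
  simp only [bilinearLAM, weightVec, liftedInput, PiLp.inner_apply, Fintype.sum_prod_type,
    dotProduct, Matrix.mulVec, Matrix.vec, Matrix.vecMulVec_apply, Matrix.transpose_apply,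
    Finset.mul_sum, RCLike.inner_apply, conj_trivial]
  refine Finset.sum_congr rfl fun i _ => Finset.sum_congr rfl fun j _ => ?_
  ring

/-- The class `H` of linear functions `h(x̃) = w̃ᵀ x̃` with `w̃ = vec(Wᵀ)` and `‖w̃‖₂ ≤ Bw`. -/
def lamClass (m b : ℕ) (Bw : ℝ) : Set (EuclideanSpace ℝ (Fin m × Fin b) → ℝ) :=
  {h | ∃ W : Matrix (Fin m) (Fin b) ℝ, ‖weightVec W‖ ≤ Bw ∧ ∀ z, h z = ⟪weightVec W, z⟫}

/-- The distribution `Q` of `x̃ = vec(ψ(x) aᵀ)` when `x` has law `μ` and `a` is fixed. -/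
def sourceLaw {d b m : ℕ} (μ : Measure (EuclideanSpace ℝ (Fin d)))
    (ψ : EuclideanSpace ℝ (Fin d) → EuclideanSpace ℝ (Fin b))
    (a : EuclideanSpace ℝ (Fin m)) : Measure (EuclideanSpace ℝ (Fin m × Fin b)) :=
  μ.map (liftedInput ψ a)

/-- The loss `ℓ_q(y, y') = |y - y'|^q`. -/
def lqLoss (q : ℝ) (y y' : ℝ) : ℝ := |y - y'| ^ q

/-- The expected risk `J_Q(h) = E_Q[ℓ(h(x̃), f(x̃))]`. -/
def expectedRisk {Z : Type*} [MeasurableSpace Z] (ℓ : ℝ → ℝ → ℝ) (Q : Measure Z)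
    (f h : Z → ℝ) : ℝ :=
  ∫ z, ℓ (h z) (f z) ∂Q

/-- The empirical risk `(1/n) ∑ᵢ ℓ(h(x̃ᵢ), f(x̃ᵢ))` on the sample `S = (x̃₁, …, x̃ₙ)`. -/
def empiricalRisk {Z : Type*} {n : ℕ} (ℓ : ℝ → ℝ → ℝ) (S : Fin n → Z) (f h : Z → ℝ) : ℝ :=
  (1 / (n : ℝ)) * ∑ i, ℓ (h (S i)) (f (S i))

end

/-!
By almost sure boundedness, the loss `|t| ^ q` may be replaced by its truncation at `|t| = M`, which
takes values in `[0, M ^ q]` and is Lipschitz with constant `q * M ^ (q - 1)`. Changing one sample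
point then moves the uniform deviation `sup_h (J_Q(h) - Ĵ_Q(h))` by at most `M ^ q / n`, so
McDiarmid's inequality puts it within `M ^ q * √(log (1 / δ) / (2 * n))` of its mean, with
probability at least `1 - δ`. Symmetrization bounds that mean by twice the Rademacher complexity of
the loss class. The Ledoux–Talagrand contraction principle removes the loss at the price of its
Lipschitz constant, and what remains is the complexity of a ball of linear functions, at most
`Bw * Bx * Ba / √n` because distinct signs are uncorrelated. The supremum over the uncountable ball
of weights is reduced to a dense sequence, since both risks are continuous in the weight.
-/

open ProbabilityTheory
open scoped BigOperators NNReal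

section BoundedDifferences

/-- The bounded differences condition of McDiarmid's inequality: changing the `i`-th coordinate
changes the value of `F` by at most `c i`. -/
def HasBoundedDifferences {ι : Type*} [DecidableEq ι] {Z : ι → Type*} (F : (∀ i, Z i) → ℝ)
    (c : ι → ℝ≥0) : Prop :=
  ∀ S i z, |F (Function.update S i z) - F S| ≤ c i

theorem hasSubgaussianMGF_of_abs_sub_le {Ω : Type*} [MeasurableSpace Ω] {P : Measure Ω}
    [IsProbabilityMeasure P] {X : Ω → ℝ} (hX : AEMeasurable X P) {c : ℝ≥0}
    (hc : ∀ ω ω', |X ω - X ω'| ≤ c) :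
    HasSubgaussianMGF (fun ω => X ω - ∫ ω', X ω' ∂P) ((c / 2) ^ 2) P := by
  obtain ⟨ω₀⟩ := P.nonempty_of_neZero
  have : Nonempty Ω := ⟨ω₀⟩
  have hbdd : BddBelow (Set.range X) :=
    ⟨X ω₀ - c, by rintro _ ⟨ω, rfl⟩; linarith [le_of_abs_le (hc ω₀ ω)]⟩
  have hIcc : ∀ ω, X ω ∈ Set.Icc (⨅ ω', X ω') ((⨅ ω', X ω') + c) := fun ω =>
    ⟨ciInf_le hbdd ω, sub_le_iff_le_add.1 <|
      le_ciInf fun ω' => by linarith [le_of_abs_le (hc ω ω')]⟩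
  simpa using hasSubgaussianMGF_of_mem_Icc hX (ae_of_all _ hIcc)

theorem hasSubgaussianMGF_prod_add {Ω Ω' : Type*} [MeasurableSpace Ω] [MeasurableSpace Ω']
    {P : Measure Ω} {P' : Measure Ω'} [SFinite P] [SFinite P'] {X : Ω → ℝ} {Y : Ω × Ω' → ℝ}
    (hY : AEStronglyMeasurable Y (P.prod P')) {cX cY : ℝ≥0} (hXc : HasSubgaussianMGF X cX P)
    (hYc : ∀ ω, HasSubgaussianMGF (fun ω' => Y (ω, ω')) cY P') :
    HasSubgaussianMGF (fun p => X p.1 + Y p) (cX + cY) (P.prod P') := by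
  have hsplit : ∀ t ω, ∫ ω', Real.exp (t * (X ω + Y (ω, ω'))) ∂P' =
      Real.exp (t * X ω) * mgf (fun ω' => Y (ω, ω')) P' t := fun t ω => by
    simp only [mul_add, Real.exp_add, integral_const_mul, mgf]
  have hle : ∀ t ω, ∫ ω', Real.exp (t * (X ω + Y (ω, ω'))) ∂P' ≤
      Real.exp (t * X ω) * Real.exp (cY * t ^ 2 / 2) := fun t ω => by
    rw [hsplit]
    gcongr
    exact (hYc ω).mgf_le t
  have hint : ∀ t, Integrable (fun p : Ω × Ω' => Real.exp (t * (X p.1 + Y p))) (P.prod P') := by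
    intro t
    have hmeas : AEStronglyMeasurable (fun p : Ω × Ω' => Real.exp (t * (X p.1 + Y p)))
        (P.prod P') :=
      Real.continuous_exp.comp_aestronglyMeasurable
        ((hXc.aestronglyMeasurable.comp_fst.add hY).const_mul t)
    refine (integrable_prod_iff hmeas).2 ⟨ae_of_all _ fun ω => ?_, ?_⟩
    · simpa only [mul_add, Real.exp_add] using ((hYc ω).integrable_exp_mul t).const_mul _
    · refine ((hXc.integrable_exp_mul t).mul_const (Real.exp (cY * t ^ 2 / 2))).mono'
        hmeas.norm.integral_prod_right' (ae_of_all _ fun ω => ?_)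
      rw [Real.norm_of_nonneg (integral_nonneg fun _ => norm_nonneg _)]
      simpa only [Real.norm_eq_abs, Real.abs_exp] using hle t ω
  refine ⟨hint, fun t => ?_⟩
  calc mgf (fun p : Ω × Ω' => X p.1 + Y p) (P.prod P') t
      = ∫ ω, ∫ ω', Real.exp (t * (X ω + Y (ω, ω'))) ∂P' ∂P := integral_prod _ (hint t)
    _ ≤ ∫ ω, Real.exp (t * X ω) * Real.exp (cY * t ^ 2 / 2) ∂P :=
        integral_mono (hint t).integral_prod_left ((hXc.integrable_exp_mul t).mul_const _) (hle t)
    _ = mgf X P t * Real.exp (cY * t ^ 2 / 2) := integral_mul_const _ _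
    _ ≤ Real.exp (cX * t ^ 2 / 2) * Real.exp (cY * t ^ 2 / 2) := by
        gcongr
        exact hXc.mgf_le t
    _ = Real.exp ((cX + cY : ℝ≥0) * t ^ 2 / 2) := by
        rw [← Real.exp_add, NNReal.coe_add]
        ring_nf

theorem hasSubgaussianMGF_prod_of_abs_sub_le {Ω Ω' : Type*} [MeasurableSpace Ω]
    [MeasurableSpace Ω'] {P : Measure Ω} {P' : Measure Ω'} [IsProbabilityMeasure P]
    [IsProbabilityMeasure P'] {F : Ω × Ω' → ℝ} (hF : Measurable F) {c c' : ℝ≥0}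
    (hc : ∀ ω₁ ω₂ ω', |F (ω₁, ω') - F (ω₂, ω')| ≤ c)
    (hc' : ∀ ω, HasSubgaussianMGF (fun ω' => F (ω, ω') - ∫ η, F (ω, η) ∂P') c' P') :
    HasSubgaussianMGF (fun p => F p - ∫ p', F p' ∂P.prod P') ((c / 2) ^ 2 + c')
      (P.prod P') := by
  set G : Ω → ℝ := fun ω => ∫ ω', F (ω, ω') ∂P'
  have hGm : Measurable G := hF.stronglyMeasurable.integral_prod_right'.measurable
  have hFint : ∀ ω, Integrable (fun ω' => F (ω, ω')) P' := fun ω => by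
    simpa only [Pi.add_def, G, sub_add_cancel] using
      (hc' ω).integrable.add (integrable_const (G ω))
  have hGc : ∀ ω₁ ω₂, |G ω₁ - G ω₂| ≤ c := fun ω₁ ω₂ => by
    have hnorm := norm_integral_le_of_norm_le_const (μ := P')
      (f := fun ω' => F (ω₁, ω') - F (ω₂, ω')) (ae_of_all _ (hc ω₁ ω₂))
    rwa [integral_sub (hFint ω₁) (hFint ω₂), probReal_univ, mul_one] at hnorm
  have hsum := hasSubgaussianMGF_prod_add (Y := fun p => F p - G p.1)
    (hF.sub (hGm.comp measurable_fst)).aestronglyMeasurable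
    (hasSubgaussianMGF_of_abs_sub_le (P := P) hGm.aemeasurable hGc) hc'
  have heq : ∀ p : Ω × Ω', G p.1 - ∫ ω, G ω ∂P + (F p - G p.1) = F p - ∫ ω, G ω ∂P :=
    fun p => by ring
  simp only [heq] at hsum
  have hFi : Integrable F (P.prod P') := by
    simpa only [Pi.add_def, sub_add_cancel] using
      hsum.integrable.add (integrable_const (∫ ω, G ω ∂P))
  rwa [integral_prod F hFi]

theorem measurePreserving_finCons {n : ℕ} {Z : Fin (n + 1) → Type*}
    [∀ i, MeasurableSpace (Z i)] (ν : ∀ i, Measure (Z i)) [∀ i, SigmaFinite (ν i)] :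
    MeasurePreserving (fun p : Z 0 × (∀ i : Fin n, Z i.succ) => (Fin.cons p.1 p.2 : ∀ i, Z i))
      ((ν 0).prod (Measure.pi fun i => ν i.succ)) (Measure.pi ν) := by
  have hmeas : Measurable fun p : Z 0 × (∀ i : Fin n, Z i.succ) =>
      (Fin.cons p.1 p.2 : ∀ i, Z i) :=
    measurable_pi_iff.2 <| Fin.cases (by simpa using measurable_fst) fun i => by
      simpa using by fun_prop
  refine ⟨hmeas, (Measure.pi_eq fun s hs => ?_).symm⟩
  have hpre : (fun p : Z 0 × (∀ i : Fin n, Z i.succ) => (Fin.cons p.1 p.2 : ∀ i, Z i)) ⁻¹'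
      Set.univ.pi s = s 0 ×ˢ Set.univ.pi fun i : Fin n => s i.succ := by
    ext p
    simp [Fin.forall_fin_succ]
  rw [Measure.map_apply hmeas (.univ_pi hs), hpre, Measure.prod_prod, Measure.pi_pi,
    Fin.prod_univ_succ]

theorem HasBoundedDifferences.hasSubgaussianMGF :
    ∀ {n : ℕ} {Z : Fin n → Type*} [∀ i, MeasurableSpace (Z i)] (ν : ∀ i, Measure (Z i))
      [∀ i, IsProbabilityMeasure (ν i)] {F : (∀ i, Z i) → ℝ} {c : Fin n → ℝ≥0},
      HasBoundedDifferences F c → Measurable F →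
        HasSubgaussianMGF (fun S => F S - ∫ T, F T ∂Measure.pi ν) (∑ i, (c i / 2) ^ 2)
          (Measure.pi ν)
  | 0, _, _, ν, _, F, _, _, _ => by
    have hconst : ∀ S, F S - ∫ T, F T ∂Measure.pi ν = 0 := fun S => by
      simp [Subsingleton.elim _ S]
    simp [hconst]
  | n + 1, Z, _, ν, _, F, c, hFc, hF => by
    have hcons := measurePreserving_finCons ν
    have hprod := hasSubgaussianMGF_prod_of_abs_sub_le (P := ν 0)
      (P' := Measure.pi fun i : Fin n => ν i.succ) (F := fun p => F (Fin.cons p.1 p.2))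
      (c := c 0) (c' := ∑ i : Fin n, (c i.succ / 2) ^ 2)
      (hF.comp hcons.measurable) (fun z w S => by
        simpa only [Fin.update_cons_zero] using hFc (Fin.cons w S) 0 z) fun z =>
      HasBoundedDifferences.hasSubgaussianMGF (fun i : Fin n => ν i.succ)
        (F := fun S => F (Fin.cons z S))
        (fun S i w => by simpa only [Fin.cons_update] using hFc (Fin.cons z S) i.succ w)
        (hF.comp (hcons.measurable.comp measurable_prodMk_left))
    rw [Fin.sum_univ_succ]
    have hid : IdentDistrib (fun p : Z 0 × (∀ i : Fin n, Z i.succ) => F (Fin.cons p.1 p.2)) F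
        ((ν 0).prod (Measure.pi fun i => ν i.succ)) (Measure.pi ν) :=
      ⟨(hF.comp hcons.measurable).aemeasurable, hF.aemeasurable, by
        rw [← hcons.map_eq, Measure.map_map hF hcons.measurable]; rfl⟩
    rw [hid.integral_eq] at hprod
    exact hprod.congr_identDistrib (hid.sub_const _)

theorem HasBoundedDifferences.measureReal_ge_le {n : ℕ} {Z : Fin n → Type*}
    [∀ i, MeasurableSpace (Z i)] (ν : ∀ i, Measure (Z i)) [∀ i, IsProbabilityMeasure (ν i)]
    {F : (∀ i, Z i) → ℝ} {c : Fin n → ℝ≥0} (hFc : HasBoundedDifferences F c)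
    (hF : Measurable F) {ε : ℝ} (hε : 0 ≤ ε) :
    (Measure.pi ν).real {S | ε ≤ F S - ∫ T, F T ∂Measure.pi ν} ≤
      Real.exp (-2 * ε ^ 2 / ∑ i, (c i : ℝ) ^ 2) := by
  refine ((hFc.hasSubgaussianMGF ν hF).measure_ge_le hε).trans_eq ?_
  simp only [div_pow, ← Finset.sum_div]
  push_cast
  congr 1
  ring

theorem HasBoundedDifferences.ofReal_one_sub_le_measure {n : ℕ} {Z : Fin n → Type*}
    [∀ i, MeasurableSpace (Z i)] (ν : ∀ i, Measure (Z i)) [∀ i, IsProbabilityMeasure (ν i)]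
    {F : (∀ i, Z i) → ℝ} {c : Fin n → ℝ≥0} (hFc : HasBoundedDifferences F c)
    (hF : Measurable F) (hc : 0 < ∑ i, (c i : ℝ) ^ 2) {δ : ℝ} (hδ : 0 < δ) :
    ENNReal.ofReal (1 - δ) ≤ Measure.pi ν
      {S | F S ≤ ∫ T, F T ∂Measure.pi ν + √((∑ i, (c i : ℝ) ^ 2) * Real.log (1 / δ) / 2)} := by
  rcases lt_or_ge 1 δ with hδ1 | hδ1
  · rw [ENNReal.ofReal_of_nonpos (by linarith)]
    exact zero_le
  set ε := √((∑ i, (c i : ℝ) ^ 2) * Real.log (1 / δ) / 2)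
  have hlog : 0 ≤ Real.log (1 / δ) := Real.log_nonneg (one_le_one_div hδ hδ1)
  have hexp : Real.exp (-2 * ε ^ 2 / ∑ i, (c i : ℝ) ^ 2) = δ := by
    have harg : -2 * ε ^ 2 / ∑ i, (c i : ℝ) ^ 2 = Real.log δ := by
      rw [Real.sq_sqrt (by positivity), one_div, Real.log_inv]
      field_simp
    rw [harg, Real.exp_log hδ]
  set T := {S | ε ≤ F S - ∫ T, F T ∂Measure.pi ν}
  have hT : MeasurableSet T := measurableSet_le measurable_const (hF.sub_const _)
  have htail : (Measure.pi ν).real T ≤ δ := hexp ▸ hFc.measureReal_ge_le ν hF (Real.sqrt_nonneg _)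
  calc ENNReal.ofReal (1 - δ) ≤ ENNReal.ofReal ((Measure.pi ν).real Tᶜ) := by
        rw [probReal_compl_eq_one_sub hT]
        gcongr
    _ = Measure.pi ν Tᶜ := ofReal_measureReal
    _ ≤ _ := measure_mono fun S hS =>
        (sub_lt_iff_lt_add'.1 (not_le.1 (Set.notMem_ofPred_iff.1 hS))).le

end BoundedDifferences

section Rademacher

variable {ι κ : Type*} [Fintype ι]

theorem bddAbove_range_sum_units_smul {v : κ → ι → ℝ}
    (hv : ∀ i, ∃ C, ∀ k, |v k i| ≤ C) (σ : ι → ℤˣ) :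
    BddAbove (Set.range fun k => ∑ i, σ i • v k i) := by
  choose C hC using hv
  refine ⟨∑ i, C i, ?_⟩
  rintro _ ⟨k, rfl⟩
  exact Finset.sum_le_sum fun i _ =>
    (le_abs_self _).trans <| by simpa only [← Real.norm_eq_abs, norm_units_zsmul] using hC i k

variable [DecidableEq ι]

/-- The empirical Rademacher complexity of a class of functions indexed by `κ`, where `u k i` is the
value of the `k`-th function at the `i`-th sample point; the signs range uniformly over `ι → ℤˣ`.
The supremum takes the junk value `0` at the signs for which it is not bounded above. -/
noncomputable def rademacherComplexity (u : κ → ι → ℝ) : ℝ :=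
  𝔼 σ : ι → ℤˣ, ⨆ k, 𝔼 i, σ i • u k i

theorem rademacherComplexity_eq (u : κ → ι → ℝ) :
    rademacherComplexity u =
      (Fintype.card ι : ℝ)⁻¹ * 𝔼 σ : ι → ℤˣ, ⨆ k, ∑ i, σ i • u k i := by
  rw [rademacherComplexity, Finset.mul_expect]
  refine Finset.expect_congr rfl fun σ _ => ?_
  rw [Real.mul_iSup_of_nonneg (by positivity)]
  simp only [Fintype.expect_eq_sum_div_card, div_eq_inv_mul]

theorem expect_mul_left {G M : Type*} [Fintype G] [Group G] [AddCommMonoid M] [Module ℚ≥0 M]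
    (τ : G) (f : G → M) : 𝔼 σ, f (τ * σ) = 𝔼 σ, f σ :=
  Fintype.expect_equiv (Equiv.mulLeft τ) _ _ fun _ => rfl

section Contraction

theorem ciSup_add_ciSup_sub_le [Nonempty κ] {a s t : κ → ℝ}
    (hst : ∀ k l, |s k - s l| ≤ |t k - t l|) (hadd : BddAbove (Set.range fun k => a k + t k))
    (hsub : BddAbove (Set.range fun k => a k - t k)) :
    (⨆ k, (a k + s k)) + ⨆ k, (a k - s k) ≤ (⨆ k, (a k + t k)) + ⨆ k, (a k - t k) := by
  refine ciSup_add_ciSup_le fun k l => ?_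
  have hs := (le_abs_self _).trans (hst k l)
  have hk := le_ciSup hadd k
  have hl := le_ciSup hadd l
  have hk' := le_ciSup hsub k
  have hl' := le_ciSup hsub l
  rcases abs_cases (t k - t l) with ⟨h, _⟩ | ⟨h, _⟩ <;> linarith

theorem sum_units_smul_eq_add (σ : ι → ℤˣ) (x : ι → ℝ) (j : ι) :
    ∑ i, σ i • x i = ∑ i ∈ Finset.univ.erase j, σ i • x i + σ j • x j :=
  (Finset.sum_erase_add _ _ (Finset.mem_univ j)).symm

theorem sum_mulSingle_neg_one_mul_smul (σ : ι → ℤˣ) (x : ι → ℝ) (j : ι) :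
    ∑ i, (Pi.mulSingle j (-1) * σ : ι → ℤˣ) i • x i =
      ∑ i ∈ Finset.univ.erase j, σ i • x i - σ j • x j := by
  rw [sum_units_smul_eq_add _ _ j, sub_eq_add_neg]
  congr 1
  · refine Finset.sum_congr rfl fun i hi => ?_
    rw [Pi.mul_apply, Pi.mulSingle_eq_of_ne (Finset.ne_of_mem_erase hi), one_mul]
  · simp [Units.neg_smul]

theorem expect_ciSup_units_smul_le_of_contraction_at [Nonempty κ] {u v : κ → ι → ℝ} (j : ι)
    (hv : ∀ i, ∃ C, ∀ k, |v k i| ≤ C) (huv : ∀ i ≠ j, ∀ k, u k i = v k i)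
    (hj : ∀ k l, |u k j - u l j| ≤ |v k j - v l j|) :
    𝔼 σ : ι → ℤˣ, ⨆ k, ∑ i, σ i • u k i ≤ 𝔼 σ : ι → ℤˣ, ⨆ k, ∑ i, σ i • v k i := by
  set F : (κ → ι → ℝ) → (ι → ℤˣ) → ℝ := fun w σ => ⨆ k, ∑ i, σ i • w k i
  -- Averaging over `σ` and its flip at `j` isolates the one coordinate where `u`, `v` differ.
  set flip : ι → ℤˣ := Pi.mulSingle j (-1)
  have hpair : ∀ σ, F u σ + F u (flip * σ) ≤ F v σ + F v (flip * σ) := fun σ => by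
    have hadd := bddAbove_range_sum_units_smul hv σ
    have hsub := bddAbove_range_sum_units_smul hv (flip * σ)
    have hrest : ∀ k, ∑ i ∈ Finset.univ.erase j, σ i • u k i =
        ∑ i ∈ Finset.univ.erase j, σ i • v k i := fun k =>
      Finset.sum_congr rfl fun i hi => by rw [huv i (Finset.ne_of_mem_erase hi)]
    simp only [F, flip, sum_mulSingle_neg_one_mul_smul, sum_units_smul_eq_add σ _ j, hrest]
      at hadd hsub ⊢
    exact ciSup_add_ciSup_sub_le
      (fun k l => by simpa only [← smul_sub, ← Real.norm_eq_abs, norm_units_zsmul] using hj k l)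
      hadd hsub
  have hdouble : ∀ w, 𝔼 σ, (F w σ + F w (flip * σ)) = 2 * 𝔼 σ, F w σ := fun w => by
    rw [Finset.expect_add_distrib, expect_mul_left flip (F w), two_mul]
  have hle := Finset.expect_le_expect fun σ (_ : σ ∈ Finset.univ) => hpair σ
  rw [hdouble, hdouble] at hle
  exact le_of_mul_le_mul_left hle two_pos

theorem exists_abs_le_of_abs_sub_le [Nonempty κ] {s t : κ → ℝ} (ht : ∃ C, ∀ k, |t k| ≤ C)
    (hst : ∀ k l, |s k - s l| ≤ |t k - t l|) : ∃ C, ∀ k, |s k| ≤ C := by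
  obtain ⟨C, hC⟩ := ht
  obtain ⟨l⟩ := ‹Nonempty κ›
  exact ⟨|s l| + (C + C), fun k => by
    linarith [abs_sub_abs_le_abs_sub (s k) (s l), hst k l, abs_sub (t k) (t l), hC k, hC l]⟩

theorem expect_ciSup_units_smul_le_of_contraction [Nonempty κ] {u v : κ → ι → ℝ}
    (hv : ∀ i, ∃ C, ∀ k, |v k i| ≤ C)
    (huv : ∀ i k l, |u k i - u l i| ≤ |v k i - v l i|) :
    𝔼 σ : ι → ℤˣ, ⨆ k, ∑ i, σ i • u k i ≤ 𝔼 σ : ι → ℤˣ, ⨆ k, ∑ i, σ i • v k i := by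
  have hreplace : ∀ s : Finset ι, 𝔼 σ : ι → ℤˣ, ⨆ k, ∑ i, σ i • s.piecewise (u k) (v k) i ≤
      𝔼 σ : ι → ℤˣ, ⨆ k, ∑ i, σ i • v k i := fun s => by
    induction s using Finset.induction_on with
    | empty => simp only [Finset.piecewise_empty, le_refl]
    | insert j s hj ih =>
      refine (expect_ciSup_units_smul_le_of_contraction_at j (fun i => ?_) (fun i hi k => ?_)
        fun k l => ?_).trans ih
      · by_cases hi : i ∈ s
        · simpa only [Finset.piecewise_eq_of_mem _ _ _ hi] using
            exists_abs_le_of_abs_sub_le (hv i) (huv i)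
        · simpa only [Finset.piecewise_eq_of_notMem _ _ _ hi] using hv i
      · rw [Finset.piecewise_insert_of_ne (h := hi)]
      · simpa [hj] using huv j k l
  simpa only [Finset.piecewise_univ] using hreplace Finset.univ

theorem rademacherComplexity_le_mul_of_abs_sub_le [Nonempty κ] {u v : κ → ι → ℝ} {L : ℝ}
    (hL : 0 ≤ L) (hv : ∀ i, ∃ C, ∀ k, |v k i| ≤ C)
    (huv : ∀ i k l, |u k i - u l i| ≤ L * |v k i - v l i|) :
    rademacherComplexity u ≤ L * rademacherComplexity v := by
  have hsmul : ∀ σ : ι → ℤˣ,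
      ⨆ k, ∑ i, σ i • (L * v k i) = L * ⨆ k, ∑ i, σ i • v k i := fun σ => by
    simp only [Real.mul_iSup_of_nonneg hL, Finset.mul_sum, mul_smul_comm]
  have hbdd : ∀ i, ∃ C, ∀ k, |L * v k i| ≤ C := fun i => by
    obtain ⟨C, hC⟩ := hv i
    exact ⟨|L| * C, fun k => by rw [abs_mul]; gcongr; exact hC k⟩
  have hcontr := expect_ciSup_units_smul_le_of_contraction hbdd fun i k l => by
    simpa only [← mul_sub, abs_mul, abs_of_nonneg hL] using huv i k l
  simp only [hsmul, ← Finset.mul_expect] at hcontr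
  rw [rademacherComplexity_eq, rademacherComplexity_eq, mul_left_comm]
  gcongr

end Contraction

section LinearClass

variable {E : Type*} [NormedAddCommGroup E] [InnerProductSpace ℝ E]

theorem inner_units_smul_units_smul (ε ε' : ℤˣ) (x y : E) :
    ⟪ε • x, ε' • y⟫ = (ε * ε') • ⟪x, y⟫ := by
  obtain rfl | rfl := Int.units_eq_one_or ε <;> obtain rfl | rfl := Int.units_eq_one_or ε' <;>
    simp [Units.neg_smul]

theorem expect_units_mul_smul_of_ne {i j : ι} (hij : i ≠ j) (t : ℝ) :
    𝔼 σ : ι → ℤˣ, (σ i * σ j) • t = 0 := by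
  have hflip := expect_mul_left (Pi.mulSingle i (-1)) fun σ : ι → ℤˣ => (σ i * σ j) • t
  simp only [Pi.mul_apply, Pi.mulSingle_eq_same, Pi.mulSingle_eq_of_ne hij.symm, one_mul, neg_mul,
    Units.neg_smul, Finset.expect_neg_distrib] at hflip
  linarith

theorem expect_norm_sq_sum_units_smul (x : ι → E) :
    𝔼 σ : ι → ℤˣ, ‖∑ i, σ i • x i‖ ^ 2 = ∑ i, ‖x i‖ ^ 2 := by
  simp only [← real_inner_self_eq_norm_sq, sum_inner, inner_sum, inner_units_smul_units_smul,
    Finset.expect_sum_comm]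
  refine Finset.sum_congr rfl fun i _ => ?_
  rw [Finset.sum_eq_single i]
  · simp
  · exact fun j _ hij => expect_units_mul_smul_of_ne hij _
  · simp

theorem expect_norm_sum_units_smul_le (x : ι → E) :
    𝔼 σ : ι → ℤˣ, ‖∑ i, σ i • x i‖ ≤ √(∑ i, ‖x i‖ ^ 2) := by
  refine Real.le_sqrt_of_sq_le ?_
  rw [← expect_norm_sq_sum_units_smul]
  simpa using Finset.expect_mul_sq_le_sq_mul_sq Finset.univ
    (fun σ : ι → ℤˣ => ‖∑ i, σ i • x i‖) 1

theorem rademacherComplexity_inner_le [Nonempty κ] {w : κ → E} {B : ℝ} (hw : ∀ k, ‖w k‖ ≤ B)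
    (x : ι → E) :
    rademacherComplexity (fun k i => ⟪w k, x i⟫) ≤
      (Fintype.card ι : ℝ)⁻¹ * (B * √(∑ i, ‖x i‖ ^ 2)) := by
  have hB : 0 ≤ B := (norm_nonneg _).trans (hw (Classical.arbitrary κ))
  have hsum : ∀ (σ : ι → ℤˣ) k, ∑ i, σ i • ⟪w k, x i⟫ = ⟪w k, ∑ i, σ i • x i⟫ := fun σ k => by
    simp only [inner_sum, Units.smul_def, ← Int.cast_smul_eq_zsmul ℝ, real_inner_smul_right,
      smul_eq_mul]
  rw [rademacherComplexity_eq]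
  gcongr
  calc 𝔼 σ : ι → ℤˣ, ⨆ k, ∑ i, σ i • ⟪w k, x i⟫
      ≤ 𝔼 σ : ι → ℤˣ, B * ‖∑ i, σ i • x i‖ := Finset.expect_le_expect fun σ _ =>
        ciSup_le fun k => (hsum σ k).trans_le <| (real_inner_le_norm _ _).trans <|
          mul_le_mul_of_nonneg_right (hw k) (norm_nonneg _)
    _ = B * 𝔼 σ : ι → ℤˣ, ‖∑ i, σ i • x i‖ := (Finset.mul_expect _ _ _).symm
    _ ≤ B * √(∑ i, ‖x i‖ ^ 2) := by
        gcongr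
        exact expect_norm_sum_units_smul_le x

theorem rademacherComplexity_inner_le_of_norm_le [Nonempty κ] {w : κ → E} {B R : ℝ}
    (hw : ∀ k, ‖w k‖ ≤ B) (hR : 0 ≤ R) {x : ι → E} (hx : ∀ i, ‖x i‖ ≤ R) :
    rademacherComplexity (fun k i => ⟪w k, x i⟫) ≤ B * R / √(Fintype.card ι) := by
  have hB : 0 ≤ B := (norm_nonneg _).trans (hw (Classical.arbitrary κ))
  have hsq : ∑ i, ‖x i‖ ^ 2 ≤ Fintype.card ι * R ^ 2 := by
    simpa using Finset.sum_le_sum fun i (_ : i ∈ Finset.univ) =>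
      pow_le_pow_left₀ (norm_nonneg _) (hx i) 2
  calc rademacherComplexity (fun k i => ⟪w k, x i⟫)
      ≤ (Fintype.card ι : ℝ)⁻¹ * (B * √(Fintype.card ι * R ^ 2)) := by
        grw [rademacherComplexity_inner_le hw x, hsq]
    _ = B * R * (√(Fintype.card ι) / Fintype.card ι) := by
        rw [Real.sqrt_mul (Nat.cast_nonneg _), Real.sqrt_sq hR]
        ring
    _ = B * R / √(Fintype.card ι) := by rw [Real.sqrt_div_self, ← div_eq_mul_inv]

end LinearClass

end Rademacher

section BoundedClass

theorem bddAbove_range_of_forall_abs_le {κ : Type*} {u : κ → ℝ} {C : ℝ} (hu : ∀ k, |u k| ≤ C) :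
    BddAbove (Set.range u) :=
  ⟨C, Set.forall_mem_range.2 fun k => le_of_abs_le (hu k)⟩

theorem abs_ciSup_le_of_forall_abs_le {κ : Type*} [Nonempty κ] {u : κ → ℝ} {C : ℝ}
    (hu : ∀ k, |u k| ≤ C) : |⨆ k, u k| ≤ C :=
  abs_le.2 ⟨(neg_le_of_abs_le (hu (Classical.arbitrary κ))).trans
    (le_ciSup (bddAbove_range_of_forall_abs_le hu) _), ciSup_le fun k => le_of_abs_le (hu k)⟩

variable {ι κ : Type*} [Fintype ι] [Nonempty ι]

theorem abs_expect_le_of_forall_abs_le {u : ι → ℝ} {C : ℝ} (hu : ∀ i, |u i| ≤ C) :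
    |𝔼 i, u i| ≤ C :=
  (Finset.abs_expect_le _ _).trans (Finset.expect_le Finset.univ_nonempty fun i _ => hu i)

theorem abs_units_smul_le {t C : ℝ} (ht : |t| ≤ C) (ε : ℤˣ) : |ε • t| ≤ C := by
  rwa [← Real.norm_eq_abs, norm_units_zsmul]

variable [DecidableEq ι] [Nonempty κ]

theorem abs_rademacherComplexity_le {u : κ → ι → ℝ} {C : ℝ} (hu : ∀ k i, |u k i| ≤ C) :
    |rademacherComplexity u| ≤ C :=
  abs_expect_le_of_forall_abs_le fun σ => abs_ciSup_le_of_forall_abs_le fun k =>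
    abs_expect_le_of_forall_abs_le fun i => abs_units_smul_le (hu k i) (σ i)

theorem rademacherComplexity_sub_le {u v : κ → ι → ℝ} {C : ℝ} (hu : ∀ k i, |u k i| ≤ C)
    (hv : ∀ k i, |v k i| ≤ C) :
    rademacherComplexity (u - v) ≤ rademacherComplexity u + rademacherComplexity v := by
  rw [rademacherComplexity, rademacherComplexity, rademacherComplexity,
    ← expect_mul_left (-1) fun σ : ι → ℤˣ => ⨆ k, 𝔼 i, σ i • v k i, ← Finset.expect_add_distrib]
  refine Finset.expect_le_expect fun σ _ => ciSup_le fun k => ?_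
  have hsplit : 𝔼 i, σ i • (u - v) k i =
      𝔼 i, σ i • u k i + 𝔼 i, (-1 * σ : ι → ℤˣ) i • v k i := by
    rw [← Finset.expect_add_distrib]
    simp [Units.neg_smul, sub_eq_add_neg]
  have hbdd : ∀ {w : κ → ι → ℝ}, (∀ k i, |w k i| ≤ C) → ∀ τ : ι → ℤˣ,
      BddAbove (Set.range fun k => 𝔼 i, τ i • w k i) := fun hw τ =>
    bddAbove_range_of_forall_abs_le fun k =>
      abs_expect_le_of_forall_abs_le fun i => abs_units_smul_le (hw k i) (τ i)
  rw [hsplit]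
  exact add_le_add (le_ciSup (hbdd hu σ) k) (le_ciSup (hbdd hv (-1 * σ)) k)

theorem rademacherComplexity_comp_le {κ' : Type*} {u : κ' → ι → ℝ} {C : ℝ}
    (hu : ∀ k i, |u k i| ≤ C) (e : κ → κ') :
    rademacherComplexity (fun k => u (e k)) ≤ rademacherComplexity u :=
  Finset.expect_le_expect fun σ _ => ciSup_le fun k =>
    le_ciSup (f := fun k => 𝔼 i, σ i • u k i) (bddAbove_range_of_forall_abs_le fun k =>
      abs_expect_le_of_forall_abs_le fun i => abs_units_smul_le (hu k i) (σ i)) (e k)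

end BoundedClass

section MeasurableClass

variable {Ω ι κ : Type*} [MeasurableSpace Ω] [Fintype ι]

theorem measurable_expect {u : ι → Ω → ℝ} (hu : ∀ i, Measurable (u i)) :
    Measurable fun ω => 𝔼 i, u i ω := by
  simp only [Fintype.expect_eq_sum_div_card]
  fun_prop

theorem integral_expect {P : Measure Ω} {u : ι → Ω → ℝ} (hu : ∀ i, Integrable (u i) P) :
    ∫ ω, 𝔼 i, u i ω ∂P = 𝔼 i, ∫ ω, u i ω ∂P := by
  simp only [Fintype.expect_eq_sum_div_card]
  rw [integral_div, integral_finsetSum _ fun i _ => hu i]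

variable [Countable κ] {u : κ → ι → Ω → ℝ}

theorem measurable_ciSup_expect (hu : ∀ k i, Measurable (u k i)) :
    Measurable fun ω => ⨆ k, 𝔼 i, u k i ω :=
  Measurable.iSup fun k => measurable_expect (hu k)

theorem measurable_rademacherComplexity [DecidableEq ι] (hu : ∀ k i, Measurable (u k i)) :
    Measurable fun ω => rademacherComplexity fun k i => u k i ω :=
  measurable_expect fun σ => measurable_ciSup_expect fun k i => (hu k i).const_smul (σ i)

variable [Nonempty ι] [Nonempty κ] {C : ℝ} {P : Measure Ω} [IsFiniteMeasure P]

theorem integrable_ciSup_expect (hu : ∀ k i, Measurable (u k i)) (hC : ∀ k i ω, |u k i ω| ≤ C) :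
    Integrable (fun ω => ⨆ k, 𝔼 i, u k i ω) P :=
  .of_bound (measurable_ciSup_expect hu).aestronglyMeasurable C <| ae_of_all _ fun ω =>
    abs_ciSup_le_of_forall_abs_le fun k => abs_expect_le_of_forall_abs_le fun i => hC k i ω

theorem integrable_rademacherComplexity [DecidableEq ι] (hu : ∀ k i, Measurable (u k i))
    (hC : ∀ k i ω, |u k i ω| ≤ C) :
    Integrable (fun ω => rademacherComplexity fun k i => u k i ω) P :=
  .of_bound (measurable_rademacherComplexity hu).aestronglyMeasurable C <| ae_of_all _ fun ω =>
    abs_rademacherComplexity_le fun k i => hC k i ω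

end MeasurableClass

section Symmetrization

variable {ι κ Z : Type*} [Fintype ι] [MeasurableSpace Z] (ν : Measure Z)

/-- The one-sided uniform deviation between the means of the functions `g k` under `ν` and their
averages over the sample `S`. -/
noncomputable def uniformDeviation (g : κ → Z → ℝ) (S : ι → Z) : ℝ :=
  ⨆ k, (∫ z, g k z ∂ν - 𝔼 i, g k (S i))

theorem measurable_uniformDeviation [Countable κ] {g : κ → Z → ℝ} (hg : ∀ k, Measurable (g k)) :
    Measurable (uniformDeviation (ι := ι) ν g) :=
  Measurable.iSup fun k =>
    (measurable_expect fun i => (hg k).comp (measurable_pi_apply i)).const_sub _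

theorem abs_integral_sub_expect_le [Nonempty ι] [IsProbabilityMeasure ν] {g : Z → ℝ} {C : ℝ}
    (hC : ∀ z, |g z| ≤ C) (S : ι → Z) : |∫ z, g z ∂ν - 𝔼 i, g (S i)| ≤ C + C := by
  have hmean : |∫ z, g z ∂ν| ≤ C := by
    simpa using norm_integral_le_of_norm_le_const (μ := ν) (f := g) (ae_of_all _ hC)
  exact (abs_sub _ _).trans (add_le_add hmean (abs_expect_le_of_forall_abs_le fun i => hC (S i)))

theorem measurePreserving_swap_of_sign [SigmaFinite ν] (σ : ι → ℤˣ) :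
    MeasurePreserving (fun (p : ι → Z × Z) i => if σ i = 1 then p i else (p i).swap)
      (Measure.pi fun _ => ν.prod ν) (Measure.pi fun _ => ν.prod ν) := by
  refine measurePreserving_pi (fun _ => ν.prod ν) (fun _ => ν.prod ν)
    (f := fun i (p : Z × Z) => if σ i = 1 then p else p.swap) fun i => ?_
  split_ifs
  · exact MeasurePreserving.id _
  · exact Measure.measurePreserving_swap

variable [Countable κ]

theorem integral_ciSup_expect_units_smul_of_swap [SigmaFinite ν] {h : κ → Z × Z → ℝ}
    (hm : ∀ k, Measurable (h k)) (hswap : ∀ k p, h k p.swap = -h k p) (σ : ι → ℤˣ) :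
    ∫ p, ⨆ k, 𝔼 i, σ i • h k (p i) ∂(Measure.pi fun _ : ι => ν.prod ν) =
      ∫ p, ⨆ k, 𝔼 i, h k (p i) ∂(Measure.pi fun _ : ι => ν.prod ν) := by
  -- A sign `-1` in coordinate `i` swaps the two independent points of the pair `p i`.
  have hσ := measurePreserving_swap_of_sign (ι := ι) ν σ
  have hsign : ∀ (p : ι → Z × Z) k i,
      h k (if σ i = 1 then p i else (p i).swap) = σ i • h k (p i) := fun p k i => by
    obtain hi | hi := Int.units_eq_one_or (σ i) <;> simp [hi, hswap, Units.neg_smul]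
  have hmeas : Measurable fun p : ι → Z × Z => ⨆ k, 𝔼 i, h k (p i) :=
    measurable_ciSup_expect fun k i => (hm k).comp (measurable_pi_apply i)
  conv_rhs => rw [← hσ.map_eq, integral_map hσ.aemeasurable hmeas.aestronglyMeasurable]
  simp only [hsign]

variable [Nonempty ι] [Nonempty κ]

theorem integral_rademacherComplexity_of_swap [DecidableEq ι] [IsFiniteMeasure ν]
    {h : κ → Z × Z → ℝ} (hm : ∀ k, Measurable (h k)) {C : ℝ} (hC : ∀ k p, |h k p| ≤ C)
    (hswap : ∀ k p, h k p.swap = -h k p) :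
    ∫ p, rademacherComplexity (fun k i => h k (p i)) ∂(Measure.pi fun _ : ι => ν.prod ν) =
      ∫ p, ⨆ k, 𝔼 i, h k (p i) ∂(Measure.pi fun _ : ι => ν.prod ν) := by
  have hint : ∀ σ : ι → ℤˣ, Integrable (fun p : ι → Z × Z => ⨆ k, 𝔼 i, σ i • h k (p i))
      (Measure.pi fun _ => ν.prod ν) := fun σ =>
    integrable_ciSup_expect (fun k i => ((hm k).comp (measurable_pi_apply i)).const_smul (σ i))
      fun k i p => abs_units_smul_le (hC k (p i)) (σ i)
  simp only [rademacherComplexity]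
  rw [integral_expect hint]
  simp only [integral_ciSup_expect_units_smul_of_swap ν hm hswap, Fintype.expect_const]

variable [IsProbabilityMeasure ν] {g : κ → Z → ℝ} {C : ℝ}

theorem uniformDeviation_le_integral_ciSup (hg : ∀ k, Measurable (g k))
    (hC : ∀ k z, |g k z| ≤ C) (S : ι → Z) :
    uniformDeviation ν g S ≤
      ∫ S' : ι → Z, ⨆ k, 𝔼 i, (g k (S' i) - g k (S i)) ∂(Measure.pi fun _ => ν) := by
  have hdiff : ∀ k z z', |g k z - g k z'| ≤ C + C := fun k z z' =>
    (abs_sub _ _).trans (add_le_add (hC k z) (hC k z'))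
  have hmeas : ∀ k i, Measurable fun S' : ι → Z => g k (S' i) - g k (S i) := fun k i =>
    ((hg k).comp (measurable_pi_apply i)).sub_const _
  have hint : ∀ k i, Integrable (fun S' : ι → Z => g k (S' i)) (Measure.pi fun _ => ν) :=
    fun k i => .of_bound ((hg k).comp (measurable_pi_apply i)).aestronglyMeasurable C
      (ae_of_all _ fun S' => hC k (S' i))
  refine ciSup_le fun k => ?_
  have hmean : ∫ z, g k z ∂ν - 𝔼 i, g k (S i) =
      ∫ S' : ι → Z, 𝔼 i, (g k (S' i) - g k (S i)) ∂(Measure.pi fun _ => ν) := by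
    have hsub : ∀ i, Integrable (fun S' : ι → Z => g k (S' i) - g k (S i))
        (Measure.pi fun _ => ν) := fun i => (hint k i).sub (integrable_const _)
    rw [integral_expect hsub]
    simp only [integral_sub (hint k _) (integrable_const _), integral_const, probReal_univ,
      one_smul, Finset.expect_sub_distrib,
      integral_comp_eval (μ := fun _ : ι => ν) (hg k).aestronglyMeasurable, Fintype.expect_const]
  rw [hmean]
  refine integral_mono ?_ (integrable_ciSup_expect hmeas fun k i S' => hdiff k _ _) fun S' =>
    le_ciSup (bddAbove_range_of_forall_abs_le fun k =>
      abs_expect_le_of_forall_abs_le fun i => hdiff k (S' i) (S i)) k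
  exact .of_bound (measurable_expect (hmeas k)).aestronglyMeasurable (C + C)
    (ae_of_all _ fun S' => abs_expect_le_of_forall_abs_le fun i => hdiff k _ _)

theorem integral_uniformDeviation_le_integral_ciSup (hg : ∀ k, Measurable (g k))
    (hC : ∀ k z, |g k z| ≤ C) :
    ∫ S : ι → Z, uniformDeviation ν g S ∂(Measure.pi fun _ => ν) ≤
      ∫ p : ι → Z × Z, ⨆ k, 𝔼 i, (g k (p i).2 - g k (p i).1) ∂(Measure.pi fun _ => ν.prod ν) := by
  set P := Measure.pi fun _ : ι => ν
  have hint : Integrable (fun p : (ι → Z) × (ι → Z) => ⨆ k, 𝔼 i, (g k (p.2 i) - g k (p.1 i)))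
      (P.prod P) :=
    integrable_ciSup_expect (C := C + C)
      (fun k i => by have := hg k; fun_prop)
      fun k i p => (abs_sub _ _).trans (add_le_add (hC k _) (hC k _))
  have hdev : Integrable (fun S : ι → Z => uniformDeviation ν g S) P :=
    .of_bound (measurable_uniformDeviation ν hg).aestronglyMeasurable (C + C) <|
      ae_of_all _ fun S => abs_ciSup_le_of_forall_abs_le fun k =>
        abs_integral_sub_expect_le ν (hC k) S
  calc ∫ S, uniformDeviation ν g S ∂P
      ≤ ∫ S, ∫ S', ⨆ k, 𝔼 i, (g k (S' i) - g k (S i)) ∂P ∂P :=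
        integral_mono hdev hint.integral_prod_left (uniformDeviation_le_integral_ciSup ν hg hC)
    _ = ∫ p, ⨆ k, 𝔼 i, (g k (p.2 i) - g k (p.1 i)) ∂P.prod P := (integral_prod _ hint).symm
    _ = _ := ((measurePreserving_arrowProdEquivProdArrow Z Z ι (fun _ => ν)
        (fun _ => ν)).integral_comp' _).symm

theorem integral_uniformDeviation_le [DecidableEq ι] (hg : ∀ k, Measurable (g k))
    (hC : ∀ k z, |g k z| ≤ C) :
    ∫ S : ι → Z, uniformDeviation ν g S ∂(Measure.pi fun _ => ν) ≤
      2 * ∫ S : ι → Z, rademacherComplexity (fun k i => g k (S i)) ∂(Measure.pi fun _ => ν) := by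
  set PP := Measure.pi fun _ : ι => ν.prod ν
  set R : (ι → Z) → ℝ := fun S => rademacherComplexity fun k i => g k (S i)
  have hdiff : ∀ k (p : Z × Z), |g k p.2 - g k p.1| ≤ C + C := fun k p =>
    (abs_sub _ _).trans (add_le_add (hC k _) (hC k _))
  have hdm : ∀ k, Measurable fun p : Z × Z => g k p.2 - g k p.1 := fun k =>
    ((hg k).comp measurable_snd).sub ((hg k).comp measurable_fst)
  have hRm : Measurable R :=
    measurable_rademacherComplexity fun k i => (hg k).comp (measurable_pi_apply i)
  have hRi : ∀ {f : Z × Z → Z}, Measurable f → Integrable (fun p => R fun i => f (p i)) PP :=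
    fun hf => integrable_rademacherComplexity
      (fun k i => (hg k).comp (hf.comp (measurable_pi_apply i))) fun k i p => hC k _
  have hmarginal : ∀ {f : Z × Z → Z}, MeasurePreserving f (ν.prod ν) ν →
      ∫ p, R (fun i => f (p i)) ∂PP = ∫ S, R S ∂(Measure.pi fun _ => ν) := fun hf => by
    have hpi := measurePreserving_pi (fun _ : ι => ν.prod ν) (fun _ => ν) fun _ => hf
    rw [← hpi.map_eq, integral_map hpi.aemeasurable hRm.aestronglyMeasurable]
  calc ∫ S, uniformDeviation ν g S ∂(Measure.pi fun _ => ν)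
      ≤ ∫ p, ⨆ k, 𝔼 i, (g k (p i).2 - g k (p i).1) ∂PP :=
        integral_uniformDeviation_le_integral_ciSup ν hg hC
    _ = ∫ p, rademacherComplexity (fun k i => g k (p i).2 - g k (p i).1) ∂PP :=
        (integral_rademacherComplexity_of_swap ν hdm hdiff fun k p => (neg_sub _ _).symm).symm
    _ ≤ ∫ p, (R (fun i => (p i).2) + R fun i => (p i).1) ∂PP :=
        integral_mono
          (integrable_rademacherComplexity (fun k i => (hdm k).comp (measurable_pi_apply i))
            fun k i p => hdiff k (p i))
          ((hRi measurable_snd).add (hRi measurable_fst)) fun p =>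
            rademacherComplexity_sub_le (fun k i => hC k (p i).2) fun k i => hC k (p i).1
    _ = 2 * ∫ S, R S ∂(Measure.pi fun _ => ν) := by
        rw [integral_add (hRi measurable_snd) (hRi measurable_fst),
          hmarginal measurePreserving_snd, hmarginal measurePreserving_fst, two_mul]

end Symmetrization

theorem expect_update_sub_expect {ι Z : Type*} [Fintype ι] [DecidableEq ι] (u : Z → ℝ)
    (S : ι → Z) (i : ι) (z : Z) :
    𝔼 j, u (Function.update S i z j) - 𝔼 j, u (S j) = (u z - u (S i)) / Fintype.card ι := by
  rw [← Finset.expect_sub_distrib, Fintype.expect_eq_sum_div_card, Finset.sum_eq_single i]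
  · simp
  · exact fun j _ hj => by simp [Function.update_of_ne hj]
  · simp

theorem forall_integral_le_of_denseRange {ι κ Z X : Type*} [Fintype ι] [MeasurableSpace Z]
    (ν : Measure Z) [IsFiniteMeasure ν] [TopologicalSpace X] [FirstCountableTopology X] {w : κ → X}
    (hw : DenseRange w) {g : X → Z → ℝ} (hgm : ∀ x, Measurable (g x))
    (hgc : ∀ z, Continuous fun x => g x z) {C : ℝ} (hC : ∀ x z, |g x z| ≤ C) {S : ι → Z} {ε : ℝ}
    (h : ∀ k, ∫ z, g (w k) z ∂ν ≤ 𝔼 i, g (w k) (S i) + ε) (x : X) :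
    ∫ z, g x z ∂ν ≤ 𝔼 i, g x (S i) + ε := by
  refine hw.induction_on (p := fun x => ∫ z, g x z ∂ν ≤ 𝔼 i, g x (S i) + ε) x
    (isClosed_le ?_ ?_) h
  · exact continuous_of_dominated (fun x => (hgm x).aestronglyMeasurable)
      (fun x => ae_of_all _ (hC x)) (integrable_const C) (ae_of_all _ hgc)
  · simp only [Fintype.expect_eq_sum_div_card]
    fun_prop

section UniformDeviation

variable {ι κ Z : Type*} [Fintype ι] [MeasurableSpace Z] (ν : Measure Z) [IsProbabilityMeasure ν]

theorem integral_sub_expect_le_uniformDeviation [Nonempty ι] {g : κ → Z → ℝ} {C : ℝ}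
    (hC : ∀ k z, |g k z| ≤ C) (S : ι → Z) (k : κ) :
    ∫ z, g k z ∂ν - 𝔼 i, g k (S i) ≤ uniformDeviation ν g S :=
  le_ciSup (bddAbove_range_of_forall_abs_le fun k => abs_integral_sub_expect_le ν (hC k) S) k

theorem abs_le_of_mem_Icc_zero {t C : ℝ} (ht : t ∈ Set.Icc 0 C) : |t| ≤ C :=
  (abs_of_nonneg ht.1).trans_le ht.2

theorem hasBoundedDifferences_uniformDeviation [DecidableEq ι] [Nonempty κ] {g : κ → Z → ℝ}
    {C : ℝ≥0} (hC : ∀ k z, g k z ∈ Set.Icc 0 (C : ℝ)) :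
    HasBoundedDifferences (uniformDeviation (ι := ι) ν g) fun _ => C / Fintype.card ι := by
  intro S i z
  have : Nonempty ι := ⟨i⟩
  have hle : ∀ S z, uniformDeviation ν g (Function.update S i z) - uniformDeviation ν g S ≤
      C / Fintype.card ι := fun S z => by
    refine sub_le_iff_le_add'.2 (ciSup_le fun k => ?_)
    have hk := integral_sub_expect_le_uniformDeviation ν
      (fun k z => abs_le_of_mem_Icc_zero (hC k z)) S k
    have hupdate := expect_update_sub_expect (g k) S i z
    have hdiv : -(C / Fintype.card ι : ℝ) ≤ (g k z - g k (S i)) / Fintype.card ι := by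
      rw [← neg_div]
      gcongr
      linarith [(hC k (S i)).2, (hC k z).1]
    linarith
  have hback := hle (Function.update S i z) (S i)
  rw [Function.update_idem, Function.update_eq_self] at hback
  push_cast
  exact abs_le.2 ⟨by linarith, hle S z⟩

theorem ofReal_one_sub_le_measure_uniformDeviation_le [Countable κ] [Nonempty κ] {n : ℕ}
    (hn : 0 < n) {g : κ → Z → ℝ} (hg : ∀ k, Measurable (g k)) {C : ℝ≥0} (hC0 : 0 < C)
    (hC : ∀ k z, g k z ∈ Set.Icc 0 (C : ℝ)) {δ : ℝ} (hδ : 0 < δ) :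
    ENNReal.ofReal (1 - δ) ≤ (Measure.pi fun _ : Fin n => ν)
      {S | uniformDeviation ν g S ≤ ∫ T : Fin n → Z, uniformDeviation ν g T ∂(Measure.pi fun _ => ν)
        + C * √(Real.log (1 / δ) / (2 * n))} := by
  have hsum : ∑ _ : Fin n, ((C / Fintype.card (Fin n) : ℝ≥0) : ℝ) ^ 2 = C ^ 2 / n := by
    simp only [NNReal.coe_div, NNReal.coe_natCast, Fintype.card_fin, Finset.sum_const,
      Finset.card_univ, nsmul_eq_mul]
    field_simp
  have hsqrt : √((C : ℝ) ^ 2 / n * Real.log (1 / δ) / 2) = C * √(Real.log (1 / δ) / (2 * n)) := by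
    rw [div_mul_eq_mul_div, div_div, mul_comm (n : ℝ), mul_div_assoc,
      Real.sqrt_mul (sq_nonneg _), Real.sqrt_sq C.coe_nonneg]
  have hmcdiarmid := (hasBoundedDifferences_uniformDeviation (ι := Fin n) ν
    hC).ofReal_one_sub_le_measure (fun _ => ν) (measurable_uniformDeviation ν hg)
    (hsum ▸ div_pos (pow_pos (NNReal.coe_pos.2 hC0) 2) (Nat.cast_pos.2 hn)) hδ
  rwa [hsum, hsqrt] at hmcdiarmid

theorem ofReal_one_sub_le_measure_forall_integral_le {X : Type*} [TopologicalSpace X]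
    [FirstCountableTopology X] [TopologicalSpace.SeparableSpace X] [Nonempty X] {n : ℕ} (hn : 0 < n)
    {g : X → Z → ℝ} (hgm : ∀ x, Measurable (g x)) (hgc : ∀ z, Continuous fun x => g x z) {C : ℝ}
    (hC0 : 0 < C) (hC : ∀ x z, g x z ∈ Set.Icc 0 C) {r : ℝ}
    (hr : ∀ᵐ S ∂(Measure.pi fun _ : Fin n => ν), rademacherComplexity (fun x i => g x (S i)) ≤ r)
    {δ : ℝ} (hδ : 0 < δ) :
    ENNReal.ofReal (1 - δ) ≤ (Measure.pi fun _ : Fin n => ν)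
      {S | ∀ x, ∫ z, g x z ∂ν ≤
        𝔼 i, g x (S i) + (2 * r + C * √(Real.log (1 / δ) / (2 * n)))} := by
  have : Nonempty (Fin n) := ⟨⟨0, hn⟩⟩
  lift C to ℝ≥0 using hC0.le
  have habs : ∀ x z, |g x z| ≤ C := fun x z => abs_le_of_mem_Icc_zero (hC x z)
  set w : ℕ → X := TopologicalSpace.denseSeq X
  have hsymm := integral_uniformDeviation_le (ι := Fin n) ν (fun k => hgm (w k)) fun k => habs (w k)
  have hmean : ∫ S : Fin n → Z, rademacherComplexity (fun k i => g (w k) (S i))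
      ∂(Measure.pi fun _ => ν) ≤ r := by
    have hint : Integrable (fun S : Fin n → Z => rademacherComplexity fun k i => g (w k) (S i))
        (Measure.pi fun _ => ν) := integrable_rademacherComplexity
      (fun k i => (hgm (w k)).comp (measurable_pi_apply i)) fun k i S => habs (w k) (S i)
    simpa using integral_mono_ae hint (integrable_const r) <| hr.mono fun S hS =>
      (rademacherComplexity_comp_le (fun x i => habs x (S i)) w).trans hS
  refine (ofReal_one_sub_le_measure_uniformDeviation_le ν hn (fun k => hgm (w k))
    (NNReal.coe_pos.1 hC0) (fun k => hC (w k)) hδ).trans (measure_mono fun S hS => ?_)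
  refine forall_integral_le_of_denseRange ν (TopologicalSpace.denseRange_denseSeq X) hgm hgc habs
    fun k => ?_
  have hk := integral_sub_expect_le_uniformDeviation ν (fun k => habs (w k)) S k
  rw [Set.mem_ofPred_eq] at hS
  linarith

end UniformDeviation

section TruncatedPower

/-- The `q`-th power loss of a residual `t`, truncated at the level `M`. It agrees with `|t| ^ q`
when `|t| ≤ M`, but it is bounded and Lipschitz on all of `ℝ`. -/
noncomputable def truncatedPow (q M t : ℝ) : ℝ := (min |t| M) ^ q

variable {q M : ℝ}

theorem truncatedPow_of_abs_le {t : ℝ} (h : |t| ≤ M) : truncatedPow q M t = |t| ^ q := by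
  rw [truncatedPow, min_eq_left h]

theorem min_abs_mem_Icc (hM : 0 ≤ M) (t : ℝ) : min |t| M ∈ Set.Icc 0 M :=
  ⟨le_min (abs_nonneg _) hM, min_le_right _ _⟩

theorem truncatedPow_mem_Icc (hq : 0 ≤ q) (hM : 0 ≤ M) (t : ℝ) :
    truncatedPow q M t ∈ Set.Icc 0 (M ^ q) := by
  obtain ⟨h₀, hM'⟩ := min_abs_mem_Icc hM t
  exact ⟨Real.rpow_nonneg h₀ q, Real.rpow_le_rpow h₀ hM' hq⟩

theorem abs_rpow_sub_rpow_le (hq : 1 ≤ q) {x y : ℝ} (hx : x ∈ Set.Icc 0 M)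
    (hy : y ∈ Set.Icc 0 M) : |x ^ q - y ^ q| ≤ q * M ^ (q - 1) * |x - y| := by
  refine (convex_Icc 0 M).norm_image_sub_le_of_norm_hasDerivWithin_le (f := fun t => t ^ q)
    (f' := fun t => q * t ^ (q - 1))
    (fun t _ => (Real.hasDerivAt_rpow_const (Or.inr hq)).hasDerivWithinAt) (fun t ht => ?_) hy hx
  rw [Real.norm_of_nonneg (mul_nonneg (by linarith) (Real.rpow_nonneg ht.1 _))]
  exact mul_le_mul_of_nonneg_left (Real.rpow_le_rpow ht.1 ht.2 (by linarith)) (by linarith)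

theorem lipschitzWith_truncatedPow (hq : 1 ≤ q) (hM : 0 ≤ M) :
    LipschitzWith (q * M ^ (q - 1)).toNNReal (truncatedPow q M) := by
  refine LipschitzWith.of_dist_le' fun s t => ?_
  have hmin : |min |s| M - min |t| M| ≤ |s - t| := calc
    |min |s| M - min |t| M| ≤ max |(|s| - |t|)| |M - M| := abs_min_sub_min_le_max _ _ _ _
    _ = |(|s| - |t|)| := by rw [sub_self, abs_zero, max_eq_left (abs_nonneg _)]
    _ ≤ |s - t| := abs_abs_sub_abs_le_abs_sub _ _
  exact (abs_rpow_sub_rpow_le hq (min_abs_mem_Icc hM s) (min_abs_mem_Icc hM t)).trans <|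
    mul_le_mul_of_nonneg_left hmin (mul_nonneg (by linarith) (Real.rpow_nonneg hM _))

end TruncatedPower

section LinearPredictors

/-- The linear predictors on an inner product space whose weight vector lies in the ball of radius
`B`. The class `lamClass` is the case of a Euclidean space indexed by `Fin m × Fin b`. -/
def linearPredictors (E : Type*) [NormedAddCommGroup E] [InnerProductSpace ℝ E] (B : ℝ) :
    Set (E → ℝ) :=
  {h | ∃ w : E, ‖w‖ ≤ B ∧ ∀ z, h z = ⟪w, z⟫}

variable {E : Type*} [NormedAddCommGroup E] [InnerProductSpace ℝ E]

theorem rademacherComplexity_residual_le {ι κ : Type*} [Fintype ι] [DecidableEq ι] [Nonempty κ]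
    {φ : ℝ → ℝ} {L : ℝ≥0} (hφ : LipschitzWith L φ) {w : κ → E} {B R : ℝ}
    (hw : ∀ k, ‖w k‖ ≤ B) (hR : 0 ≤ R) {x : ι → E} (hx : ∀ i, ‖x i‖ ≤ R) (y : ι → ℝ) :
    rademacherComplexity (fun k i => φ (⟪w k, x i⟫ - y i)) ≤
      L * (B * R / √(Fintype.card ι)) := by
  have hbdd : ∀ i, ∃ C, ∀ k, |⟪w k, x i⟫| ≤ C := fun i =>
    ⟨B * ‖x i‖, fun k => (abs_real_inner_le_norm _ _).trans <|
      mul_le_mul_of_nonneg_right (hw k) (norm_nonneg _)⟩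
  have hcontract : ∀ i k l, |φ (⟪w k, x i⟫ - y i) - φ (⟪w l, x i⟫ - y i)| ≤
      L * |⟪w k, x i⟫ - ⟪w l, x i⟫| := fun i k l => by
    simpa only [Real.dist_eq, sub_sub_sub_cancel_right] using
      hφ.dist_le_mul (⟪w k, x i⟫ - y i) (⟪w l, x i⟫ - y i)
  exact (rademacherComplexity_le_mul_of_abs_sub_le L.coe_nonneg hbdd hcontract).trans <|
    mul_le_mul_of_nonneg_left (rademacherComplexity_inner_le_of_norm_le hw hR hx) L.coe_nonneg

theorem empiricalRisk_eq_expect {Z : Type*} {n : ℕ} (ℓ : ℝ → ℝ → ℝ) (S : Fin n → Z)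
    (f h : Z → ℝ) : empiricalRisk ℓ S f h = 𝔼 i, ℓ (h (S i)) (f (S i)) := by
  rw [empiricalRisk, Fintype.expect_eq_sum_div_card, Fintype.card_fin, one_div_mul_eq_div]

theorem ae_pi_forall {ι Z : Type*} [Fintype ι] [MeasurableSpace Z] {ν : Measure Z} [SigmaFinite ν]
    {p : Z → Prop} (hp : ∀ᵐ z ∂ν, p z) : ∀ᵐ S ∂(Measure.pi fun _ : ι => ν), ∀ i, p (S i) :=
  Filter.eventually_all.2 fun i =>
    (Measure.quasiMeasurePreserving_eval (fun _ : ι => ν) i).ae hp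

variable [MeasurableSpace E] [BorelSpace E] [SecondCountableTopology E]

theorem ofReal_one_sub_le_measure_integral_residual_le {n : ℕ} (hn : 0 < n) (Q : Measure E)
    [IsProbabilityMeasure Q] {f : E → ℝ} (hf : Measurable f) {φ : ℝ → ℝ} {L : ℝ≥0}
    (hφ : LipschitzWith L φ) {C : ℝ} (hC0 : 0 < C) (hφC : ∀ t, φ t ∈ Set.Icc 0 C) {B R : ℝ}
    (hB : 0 ≤ B) (hR : ∀ᵐ z ∂Q, ‖z‖ ≤ R) {δ : ℝ} (hδ : 0 < δ) :
    ENNReal.ofReal (1 - δ) ≤ (Measure.pi fun _ : Fin n => Q)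
      {S | ∀ w : E, ‖w‖ ≤ B → ∫ z, φ (⟪w, z⟫ - f z) ∂Q ≤ 𝔼 i, φ (⟪w, S i⟫ - f (S i)) +
        (2 * (L * (B * R / √n)) + C * √(Real.log (1 / δ) / (2 * n)))} := by
  have : Nonempty (Metric.closedBall (0 : E) B) := ⟨⟨0, by simpa using hB⟩⟩
  have hφm := hφ.continuous
  obtain ⟨z, hz⟩ := hR.exists
  have hball : ∀ w : Metric.closedBall (0 : E) B, ‖(w : E)‖ ≤ B := fun w =>
    mem_closedBall_zero_iff.1 w.2
  have hr : ∀ᵐ S ∂(Measure.pi fun _ : Fin n => Q), rademacherComplexity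
      (fun (w : Metric.closedBall (0 : E) B) i => φ (⟪(w : E), S i⟫ - f (S i))) ≤
        L * (B * R / √n) :=
    (ae_pi_forall hR).mono fun S hS => by
      simpa using rademacherComplexity_residual_le hφ hball ((norm_nonneg z).trans hz) hS
        fun i => f (S i)
  refine (ofReal_one_sub_le_measure_forall_integral_le Q hn
    (g := fun (w : Metric.closedBall (0 : E) B) z => φ (⟪(w : E), z⟫ - f z))
    (fun w => hφm.measurable.comp (by fun_prop)) (fun z => by fun_prop) hC0 (fun w z => hφC _) hr
    hδ).trans (measure_mono fun S hS w hw => hS ⟨w, mem_closedBall_zero_iff.2 hw⟩)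

theorem mainTheorem4_general {n : ℕ} (hn : 0 < n) (Q : Measure E) [IsProbabilityMeasure Q]
    {f : E → ℝ} (hf : Measurable f) {q M B R : ℝ} (hq : 1 ≤ q) (hM : 0 < M) (hB : 0 ≤ B)
    (hR : ∀ᵐ z ∂Q, ‖z‖ ≤ R) (hbound : ∀ᵐ z ∂Q, ∀ h ∈ linearPredictors E B, |h z - f z| ≤ M)
    {δ : ℝ} (hδ : 0 < δ) :
    ENNReal.ofReal (1 - δ) ≤ (Measure.pi fun _ : Fin n => Q)
      {S | ∀ h ∈ linearPredictors E B,
        expectedRisk (lqLoss q) Q f h ≤ empiricalRisk (lqLoss q) S f h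
          + 2 * q * M ^ (q - 1) * (B * R) / √(n : ℝ)
          + M ^ q * √(Real.log (1 / δ) / (2 * (n : ℝ)))} := by
  have hdev := ofReal_one_sub_le_measure_integral_residual_le hn Q hf
    (lipschitzWith_truncatedPow hq hM.le) (Real.rpow_pos_of_pos hM q)
    (truncatedPow_mem_Icc (by linarith) hM.le) hB hR hδ
  rw [Real.coe_toNNReal _ (by positivity)] at hdev
  refine hdev.trans (measure_mono_ae ((ae_pi_forall hbound).mono fun S hS hdev h hh => ?_))
  obtain ⟨w, hw, hhw⟩ := id hh
  have htrunc : ∀ {z}, |h z - f z| ≤ M →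
      lqLoss q (h z) (f z) = truncatedPow q M (⟪w, z⟫ - f z) := fun {z} hz => by
    rw [← hhw z, truncatedPow_of_abs_le hz, lqLoss]
  have hexpected : expectedRisk (lqLoss q) Q f h = ∫ z, truncatedPow q M (⟪w, z⟫ - f z) ∂Q :=
    integral_congr_ae (hbound.mono fun z hz => htrunc (hz h hh))
  have hempirical : empiricalRisk (lqLoss q) S f h =
      𝔼 i, truncatedPow q M (⟪w, S i⟫ - f (S i)) := by
    simp only [empiricalRisk_eq_expect, htrunc (hS _ h hh)]
  rw [hexpected, hempirical]
  refine (hdev w hw).trans_eq ?_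
  ring

end LinearPredictors

section BilinearModel

variable {d b m : ℕ}

theorem norm_liftedInput (ψ : EuclideanSpace ℝ (Fin d) → EuclideanSpace ℝ (Fin b))
    (a : EuclideanSpace ℝ (Fin m)) (x : EuclideanSpace ℝ (Fin d)) :
    ‖liftedInput ψ a x‖ = ‖ψ x‖ * ‖a‖ := by
  rw [EuclideanSpace.norm_eq, EuclideanSpace.norm_eq, EuclideanSpace.norm_eq,
    ← Real.sqrt_mul (Finset.sum_nonneg fun _ _ => sq_nonneg _), Fintype.sum_prod_type, mul_comm,
    Finset.sum_mul_sum]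
  simp only [liftedInput, Matrix.vec, Matrix.vecMulVec_apply, norm_mul, mul_pow, mul_comm]

theorem measurable_liftedInput {ψ : EuclideanSpace ℝ (Fin d) → EuclideanSpace ℝ (Fin b)}
    (hψ : Measurable ψ) (a : EuclideanSpace ℝ (Fin m)) : Measurable (liftedInput ψ a) := by
  refine (WithLp.measurable_toLp 2 _).comp (measurable_pi_iff.2 fun p => ?_)
  simp only [Matrix.vec, Matrix.vecMulVec_apply]
  fun_prop

theorem ae_sourceLaw_norm_le {μ : Measure (EuclideanSpace ℝ (Fin d))}
    {ψ : EuclideanSpace ℝ (Fin d) → EuclideanSpace ℝ (Fin b)} (hψ : Measurable ψ)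
    {a : EuclideanSpace ℝ (Fin m)} {Bx Ba : ℝ} (hx : ∀ᵐ x ∂μ, ‖ψ x‖ ≤ Bx) (ha : ‖a‖ ≤ Ba) :
    ∀ᵐ z ∂(sourceLaw μ ψ a), ‖z‖ ≤ Bx * Ba := by
  rw [sourceLaw, ae_map_iff (measurable_liftedInput hψ a).aemeasurable
    (measurableSet_le measurable_norm measurable_const)]
  filter_upwards [hx] with x hx
  grw [norm_liftedInput, hx, ha]
  exact (norm_nonneg _).trans hx

theorem weightVec_surjective : Function.Surjective (weightVec (b := b) (m := m)) :=
  fun w => ⟨Matrix.of fun i j => w (i, j), rfl⟩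

theorem lamClass_eq_linearPredictors (m b : ℕ) (Bw : ℝ) :
    lamClass m b Bw = linearPredictors (EuclideanSpace ℝ (Fin m × Fin b)) Bw := by
  ext h
  exact weightVec_surjective.exists (p := fun w => ‖w‖ ≤ Bw ∧ ∀ z, h z = ⟪w, z⟫).symm

end BilinearModel

theorem mainTheorem4 {d b m n : ℕ} (hn : 0 < n)
    (μ : Measure (EuclideanSpace ℝ (Fin d))) [IsProbabilityMeasure μ]
    (ψ : EuclideanSpace ℝ (Fin d) → EuclideanSpace ℝ (Fin b)) (hψ : Measurable ψ)
    (fQ : EuclideanSpace ℝ (Fin m × Fin b) → ℝ) (hfQ : Measurable fQ)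
    (a : EuclideanSpace ℝ (Fin m))
    (q M Bw Bx Ba : ℝ) (hq : 1 ≤ q) (hM : 0 < M) (hBw : 0 < Bw)
    (hx : ∀ᵐ x ∂μ, ‖ψ x‖ ≤ Bx) (ha : ‖a‖ ≤ Ba)
    (hbound : ∀ᵐ z ∂(sourceLaw μ ψ a), ∀ h ∈ lamClass m b Bw, |h z - fQ z| ≤ M)
    (δ : ℝ) (hδ : 0 < δ) :
    ENNReal.ofReal (1 - δ) ≤
      (Measure.pi fun _ : Fin n => sourceLaw μ ψ a)
        {S | ∀ h ∈ lamClass m b Bw,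
          expectedRisk (lqLoss q) (sourceLaw μ ψ a) fQ h ≤
            empiricalRisk (lqLoss q) S fQ h
              + 2 * q * M ^ (q - 1) * (Bw * Bx * Ba) / √(n : ℝ)
              + M ^ q * √(Real.log (1 / δ) / (2 * (n : ℝ)))} := by
  have : IsProbabilityMeasure (sourceLaw μ ψ a) :=
    Measure.isProbabilityMeasure_map (measurable_liftedInput hψ a).aemeasurable
  rw [lamClass_eq_linearPredictors] at hbound ⊢
  rw [mul_assoc Bw]
  exact mainTheorem4_general hn _ hfQ hq hM hBw.le (ae_sourceLaw_norm_le hψ hx ha) hbound hδ
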